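/- Let $f:\mathbb{R}\to\mathbb{R}$ be locally Lipschitz continuous with $f(0)=0$ and $uf(u)>0$ for all $u\neq 0$, and let $g:[0,\infty)\to\mathbb{R}$ be continuous with $g(t)>0$ for all $t>0$. Suppose that $f$ is regularly varying at $0$ with index $\beta>1$, that is, $\lim_{u\to0^+} f(\lambda u)/f(u)=\lambda^{\beta}$ for every $\lambda>0$, and that $g$ is regularly varying at infinity with index $-\theta$ for some $\theta>0$, that is, $\lim_{t\to\infty} g(\lambda t)/g(t)=\lambda^{-\theta}$ for every $\lambda>0$. Let $F(u)=\int_u^1 \frac{dv}{f(v)}$ for $u>0$, and let $F^{-1}$ be the inverse of the strictly decreasing function $F$ on $(0,\infty)$ (it is defined on $[0,\infty)$). Let $\xi>0$, let $x$ be the unique continuous solution on $[0,\infty)$ of $$x'(t)=-f(x(t))+g(t),\quad t>0;\qquad x(0)=\xi,$$ and suppose that $x(t)\to0$ as $t\to\infty$. Suppose finally that the limit $$L:=\lim_{t\to\infty}\frac{g(t)}{f(F^{-1}(t))}\in[0,\infty]$$ exists. (i) If $L=0$, then $\displaystyle\lim_{t\to\infty}\frac{F(x(t))}{t}=1$. (ii)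 If $0<L<\infty$, then the equation $(1-\Lambda)\Lambda^{-\beta/(\beta-1)}=L$ has exactly one solution $\Lambda_*(L)$ in $(0,1)$, and $\displaystyle\lim_{t\to\infty}\frac{F(x(t))}{t}=\Lambda_*(L)$. (iii) If $L=\infty$, then $\displaystyle\lim_{t\to\infty}\frac{f(x(t))}{g(t)}=1$. -/

import Mathlib

open Filter Topology Set

/-- `f ∈ RV_0(β)`: `f` is measurable and positive on a right neighbourhood `(0, δ)` of `0`, and
`f (lam * x) / f x → lam ^ β` as `x → 0+`, for every `lam > 0`. -/
def RegVaryingAtZero (f : ℝ → ℝ) (β : ℝ) : Prop :=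
  (∃ δ : ℝ, 0 < δ ∧ Measurable ((Ioo 0 δ).domRestrict f) ∧ ∀ x ∈ Ioo 0 δ, 0 < f x) ∧
    ∀ lam : ℝ, 0 < lam → Tendsto (fun x => f (lam * x) / f x) (𝓝[>] 0) (𝓝 (lam ^ β))

/-- `h ∈ RV_∞(α)`: `h` is measurable and positive on a neighbourhood `(T, ∞)` of infinity, and
`h (lam * t) / h t → lam ^ α` as `t → ∞`, for every `lam > 0`. -/
def RegVaryingAtTop (h : ℝ → ℝ) (α : ℝ) : Prop :=
  (∃ T : ℝ, Measurable ((Ioi T).domRestrict h) ∧ ∀ t ∈ Ioi T, 0 < h t) ∧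
    ∀ lam : ℝ, 0 < lam → Tendsto (fun t => h (lam * t) / h t) atTop (𝓝 (lam ^ α))

/-- `F(x) = ∫_x^1 du / f(u)`, meaningful for `x > 0` (with the usual orientation if `x > 1`). -/
noncomputable def odeF (f : ℝ → ℝ) (x : ℝ) : ℝ :=
  ∫ u in x..1, 1 / f u

/-- The inverse `F⁻¹` of `F : (0, ∞) → ℝ`. For `f` continuous and positive on `(0, ∞)` the function
`F` is strictly decreasing there, so that on the range of `F` this is the unique preimage; values
off that range are irrelevant. -/
noncomputable def odeFInv (f : ℝ → ℝ) : ℝ → ℝ :=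
  Function.invFunOn (odeF f) (Ioi 0)

/-- `x` is a continuous solution on `[0, ∞)` of `x'(t) = -f(x(t)) + g(t)`, `t > 0`, `x(0) = ξ`. -/
structure IsPerturbedSolution (f g : ℝ → ℝ) (ξ : ℝ) (x : ℝ → ℝ) : Prop where
  continuousOn : ContinuousOn x (Ici 0)
  initial : x 0 = ξ
  hasDerivAt : ∀ t : ℝ, 0 < t → HasDerivAt x (-f (x t) + g t) t

/-!
The function `z = F(x)` satisfies `z' = 1 - g / φ(z)`, where `φ = f ∘ F⁻¹` varies regularly at
infinity with index `-γ`, `γ = β / (β - 1)`. By the uniform convergence theorem, `z(t) ≥ b t`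
forces `φ(z(t)) ≤ (1 + o(1)) b ^ (-γ) φ(t)`. If `g / φ → L < ∞`, then `z' - b` is therefore bounded
above by a negative constant wherever `z(t) ≥ b t`, as soon as `1 - b < L b ^ γ`, so `z` ends up
below the line `b t`. The symmetric argument from below squeezes `z(t) / t` to the root of
`1 - Λ = L Λ ^ γ`. If `L = ∞`, the upper comparison gives `z(t) = o(t)`. For `c` close to `1`, `g`
hardly varies on `[c t, t]`; if moreover `φ(z(t)) / g(t)` were away from `1`, then by the near
monotonicity of `φ` the derivative `z'` would stay away from `0` on `[c t, t]`, so that `z` would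
change by a fixed multiple of `t` there.
-/

/-! ### The uniform convergence theorem -/

section UniformConvergence

open MeasureTheory

theorem tendstoInMeasure_add_sub {h : ℝ → ℝ} (hm : Measurable h)
    (hh : ∀ u, Tendsto (fun s => h (s + u) - h s) atTop (𝓝 0)) {s : ℕ → ℝ}
    (hs : Tendsto s atTop atTop) (a b : ℝ) :
    TendstoInMeasure (volume.restrict (Icc a b)) (fun n v => h (s n + v) - h (s n)) atTop 0 :=
  tendstoInMeasure_of_tendsto_ae
    (fun n => ((hm.comp (measurable_const_add (s n))).sub_const _).aestronglyMeasurable)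
    (ae_of_all _ fun v => (hh v).comp hs)

theorem exists_notMem_sub_notMem_of_volume_lt_half {B C : Set ℝ} {u : ℝ} (hu : u ∈ Icc (-1 : ℝ) 1)
    (hB : volume.restrict (Icc (-1) 2) B < 1 / 2) (hC : volume.restrict (Icc (-1) 2) C < 1 / 2) :
    ∃ v, v ∉ B ∧ v - u ∉ C := by
  by_contra! hcover
  have hsub : Icc (0 : ℝ) 1 ⊆ B ∩ Icc (-1) 2 ∪ (· - u) ⁻¹' (C ∩ Icc (-1) 2) := by
    intro v hv
    by_cases hvB : v ∈ B
    · exact Or.inl ⟨hvB, by linarith [hv.1], by linarith [hv.2]⟩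
    · exact Or.inr ⟨hcover v hvB, by linarith [hv.1, hu.2], by linarith [hv.2, hu.1]⟩
  have hlt : volume (Icc (0 : ℝ) 1) < 1 := by
    calc volume (Icc (0 : ℝ) 1)
        ≤ volume (B ∩ Icc (-1) 2) + volume ((· - u) ⁻¹' (C ∩ Icc (-1) 2)) :=
          (measure_mono hsub).trans (measure_union_le _ _)
      _ = volume.restrict (Icc (-1) 2) B + volume.restrict (Icc (-1) 2) C := by
          simp only [sub_eq_add_neg, measure_preimage_add_right]
          rw [Measure.restrict_apply' measurableSet_Icc,
            Measure.restrict_apply' measurableSet_Icc]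
      _ < 1 / 2 + 1 / 2 := ENNReal.add_lt_add hB hC
      _ = 1 := ENNReal.add_halves 1
  simp at hlt

theorem tendsto_add_sub_of_measurable {h : ℝ → ℝ} (hm : Measurable h)
    (hh : ∀ u, Tendsto (fun s => h (s + u) - h s) atTop (𝓝 0)) :
    Tendsto (fun p : ℝ × ℝ => h (p.1 + p.2) - h p.1) (atTop ×ˢ 𝓟 (Icc (-1) 1)) (𝓝 0) := by
  refine tendsto_of_seq_tendsto fun p hp => ?_
  obtain ⟨hs, hu⟩ := tendsto_prod_iff'.1 hp
  have hu' : ∀ᶠ n in atTop, (p n).2 ∈ Icc (-1 : ℝ) 1 := tendsto_principal.1 hu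
  have hsu : Tendsto (fun n => (p n).1 + (p n).2) atTop atTop :=
    tendsto_atTop_add_right_of_le' _ (-1) hs (hu'.mono fun n hn => hn.1)
  refine Metric.tendsto_nhds.2 fun ε hε => ?_
  have hsmall {r : ℕ → ℝ} (hr : Tendsto r atTop atTop) := (tendstoInMeasure_iff_norm.1
    (tendstoInMeasure_add_sub hm hh hr (-1) 2) (ε / 2) (half_pos hε)).eventually_lt_const
      (show (0 : ENNReal) < 1 / 2 by simp)
  filter_upwards [hsmall hs, hsmall hsu, hu'] with n hB hC hun
  -- For most `v` the increments `h (s + v) - h s` and `h (s + v) - h (s + u)` are both small.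
  obtain ⟨v, hvB, hvC⟩ := exists_notMem_sub_notMem_of_volume_lt_half hun hB hC
  simp only [Pi.zero_apply, sub_zero, Real.norm_eq_abs, mem_ofPred_eq, not_le,
    add_add_sub_cancel] at hvB hvC
  calc dist (h ((p n).1 + (p n).2) - h (p n).1) 0
      = |(h ((p n).1 + v) - h (p n).1) - (h ((p n).1 + v) - h ((p n).1 + (p n).2))| := by
        rw [dist_zero_right, Real.norm_eq_abs, sub_sub_sub_cancel_left]
    _ ≤ |h ((p n).1 + v) - h (p n).1| + |h ((p n).1 + v) - h ((p n).1 + (p n).2)| := abs_sub _ _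
    _ < ε := by linarith

end UniformConvergence

/-! ### Regular variation -/

namespace RegVaryingAtTop

variable {g : ℝ → ℝ} {α : ℝ}

theorem eventually_pos (hg : RegVaryingAtTop g α) : ∀ᶠ t in atTop, 0 < g t := by
  obtain ⟨⟨T, -, hpos⟩, -⟩ := hg
  exact (eventually_gt_atTop T).mono hpos

theorem mul_id (hg : RegVaryingAtTop g α) : RegVaryingAtTop (fun t => g t * t) (α + 1) := by
  obtain ⟨⟨T, hm, hpos⟩, hlim⟩ := hg
  refine ⟨⟨max T 0, ?_, fun t ht => ?_⟩, fun lam hlam => ?_⟩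
  · exact (hm.comp (measurable_inclusion (Ioi_subset_Ioi (le_max_left T 0)))).mul
      measurable_subtype_coe
  · exact mul_pos (hpos t (Ioi_subset_Ioi (le_max_left T 0) ht)) ((le_max_right T 0).trans_lt ht)
  · rw [Real.rpow_add_one hlam.ne']
    refine ((hlim lam hlam).mul_const lam).congr' ?_
    filter_upwards [eventually_gt_atTop 0] with t ht
    field_simp

theorem eventually_forall_abs_log_sub_lt (hg : RegVaryingAtTop g α) {ε : ℝ} (hε : 0 < ε) :
    ∀ᶠ y in atTop, ∀ u ∈ Icc (-1 : ℝ) 1,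
      |Real.log (g (Real.exp (y + u))) - Real.log (g (Real.exp y)) - α * u| < ε := by
  obtain ⟨T, hgm, -⟩ := hg.1
  obtain ⟨p, hpm, hp⟩ :=
    (MeasurableEmbedding.subtype_coe measurableSet_Ioi).exists_measurable_extend hgm
      fun _ => inferInstance
  have hpg : ∀ t ∈ Ioi T, p t = g t := fun t ht => congrFun hp ⟨t, ht⟩
  have hexp : Tendsto Real.exp atTop atTop := Real.tendsto_exp_atTop
  have hexp_add (u : ℝ) : Tendsto (fun y => Real.exp (y + u)) atTop atTop :=
    hexp.comp (tendsto_atTop_add_const_right _ u tendsto_id)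
  have hshift := tendsto_add_sub_of_measurable
    (h := fun y => Real.log (p (Real.exp y)) - α * y) (by fun_prop) fun u => ?_
  · have hunif := eventually_prod_principal_iff.1 (Metric.tendsto_nhds.1 hshift ε hε)
    filter_upwards [hunif, hexp.eventually_gt_atTop T, (hexp_add (-1)).eventually_gt_atTop T]
      with y hy hyT hyT' u hu
    have hyu : T < Real.exp (y + u) := hyT'.trans_le (Real.exp_le_exp.2 (by linarith [hu.1]))
    convert hy u hu using 1
    rw [dist_zero_right, Real.norm_eq_abs, hpg _ hyT, hpg _ hyu]
    ring_nf
  · have hlog := (((hg.2 (Real.exp u) (Real.exp_pos u)).comp hexp).log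
      (Real.rpow_pos_of_pos (Real.exp_pos u) α).ne').sub_const (α * u)
    rw [Real.log_rpow (Real.exp_pos u), Real.log_exp, sub_self] at hlog
    refine hlog.congr' ?_
    filter_upwards [hexp.eventually_gt_atTop T, (hexp_add u).eventually_gt_atTop T,
      hexp.eventually hg.eventually_pos, (hexp_add u).eventually hg.eventually_pos]
      with y hyT hyuT hy hyu
    rw [Function.comp_apply, ← Real.exp_add, add_comm u y, Real.log_div hyu.ne' hy.ne',
      hpg _ hyT, hpg _ hyuT]
    ring

section Composition

variable {ι : Type*} {l : Filter ι} {w y : ι → ℝ}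

theorem tendsto_comp_div_one (hg : RegVaryingAtTop g α) (hy : Tendsto y l atTop)
    (hwy : Tendsto (fun i => w i / y i) l (𝓝 1)) :
    Tendsto (fun i => g (w i) / g (y i)) l (𝓝 1) := by
  have hy0 : ∀ᶠ i in l, 0 < y i := hy.eventually_gt_atTop 0
  have hwy0 : ∀ᶠ i in l, 0 < w i / y i := hwy.eventually_const_lt one_pos
  have hw : Tendsto w l atTop := by
    refine (hwy.pos_mul_atTop one_pos hy).congr' ?_
    filter_upwards [hy0] with i hi using div_mul_cancel₀ _ hi.ne'
  have hδ : Tendsto (fun i => Real.log (w i / y i)) l (𝓝 0) := by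
    simpa using hwy.log one_ne_zero
  have herr : Tendsto (fun i => Real.log (g (w i)) - Real.log (g (y i)) -
      α * Real.log (w i / y i)) l (𝓝 0) := by
    refine Metric.tendsto_nhds.2 fun ε hε => ?_
    filter_upwards [hy0, hwy0, hδ.eventually (Icc_mem_nhds (neg_one_lt_zero) one_pos),
      (Real.tendsto_log_atTop.comp hy).eventually (hg.eventually_forall_abs_log_sub_lt hε)]
      with i hi hwi hδi hunif
    have := hunif _ hδi
    rwa [Function.comp_apply, Real.exp_add, Real.exp_log hi, Real.exp_log hwi,
      mul_div_cancel₀ _ hi.ne', ← Real.norm_eq_abs, ← dist_zero_right] at this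
  have hlog : Tendsto (fun i => Real.log (g (w i)) - Real.log (g (y i))) l (𝓝 0) := by
    simpa using herr.add (hδ.const_mul α)
  rw [← Real.exp_zero]
  refine ((Real.continuous_exp.tendsto 0).comp hlog).congr' ?_
  filter_upwards [hy.eventually hg.eventually_pos, hw.eventually hg.eventually_pos] with i hi hwi
  rw [Function.comp_apply, Real.exp_sub, Real.exp_log hi, Real.exp_log hwi]

theorem tendsto_comp_div (hg : RegVaryingAtTop g α) {ρ : ℝ} (hρ : 0 < ρ)
    (hy : Tendsto y l atTop) (hwy : Tendsto (fun i => w i / y i) l (𝓝 ρ)) :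
    Tendsto (fun i => g (w i) / g (y i)) l (𝓝 (ρ ^ α)) := by
  have hρy : Tendsto (fun i => ρ * y i) l atTop := hy.const_mul_atTop hρ
  have hone : Tendsto (fun i => w i / (ρ * y i)) l (𝓝 1) := by
    simpa only [div_div, mul_comm, div_self hρ.ne'] using hwy.div_const ρ
  have hprod := (hg.tendsto_comp_div_one hρy hone).mul ((hg.2 ρ hρ).comp hy)
  rw [one_mul] at hprod
  refine hprod.congr' ?_
  filter_upwards [hρy.eventually hg.eventually_pos] with i hi
  exact div_mul_div_cancel₀ hi.ne'

end Composition

theorem exists_eventually_forall_Icc_le_mul (hg : RegVaryingAtTop g α) {r : ℝ} (hr : 1 < r) :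
    ∃ c ∈ Ioo (0 : ℝ) 1, ∀ᶠ t in atTop, ∀ s ∈ Icc (c * t) t, g s ≤ r * g t ∧ g t ≤ r * g s := by
  have hr0 : 0 < r := one_pos.trans hr
  have hlim : Tendsto (fun p : ℝ × ℝ => g (p.2 * p.1) / g p.1) (atTop ×ˢ 𝓝 1) (𝓝 1) := by
    refine hg.tendsto_comp_div_one tendsto_fst (tendsto_snd.congr' ?_)
    filter_upwards [tendsto_fst.eventually_gt_atTop (0 : ℝ)] with p hp
    exact (mul_div_cancel_right₀ _ hp.ne').symm
  obtain ⟨P, hP, Q, hQ, hPQ⟩ := eventually_prod_iff.1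
    (hlim.eventually (Ioo_mem_nhds (inv_lt_one_of_one_lt₀ hr) hr))
  obtain ⟨c, hc, hcQ⟩ := exists_Ioc_subset_of_mem_nhds hQ (exists_lt 1)
  obtain ⟨c', hc', hc'1⟩ := exists_between (max_lt hc one_pos)
  refine ⟨c', ⟨(le_max_right _ _).trans_lt hc', hc'1⟩, ?_⟩
  filter_upwards [hP, eventually_gt_atTop 0, hg.eventually_pos] with t ht ht0 hgt s hs
  have hst : s / t ∈ Ioc c 1 := ⟨((le_max_left _ _).trans_lt hc').trans_le
    ((le_div_iff₀ ht0).2 hs.1), (div_le_one ht0).2 hs.2⟩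
  obtain ⟨hlo, hhi⟩ := hPQ ht (hcQ hst)
  rw [div_mul_cancel₀ _ ht0.ne'] at hlo hhi
  rw [lt_div_iff₀ hgt, inv_mul_lt_iff₀ hr0] at hlo
  exact ⟨((div_lt_iff₀ hgt).1 hhi).le, hlo.le⟩

end RegVaryingAtTop

theorem le_add_of_unit_steps {ℓ : ℝ → ℝ} {S c : ℝ} (hone : ∀ y ≥ S, ℓ (y + 1) ≤ ℓ y)
    (hunit : ∀ y ≥ S, ∀ u ∈ Icc (0 : ℝ) 1, ℓ (y + u) ≤ ℓ y + c) {y y' : ℝ} (hy : S ≤ y)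
    (hyy' : y ≤ y') : ℓ y' ≤ ℓ y + c := by
  have hnat (n : ℕ) : ℓ (y + n) ≤ ℓ y := by
    induction n with
    | zero => simp
    | succ n ih =>
      rw [Nat.cast_succ, ← add_assoc]
      exact (hone _ (hy.trans (le_add_of_nonneg_right n.cast_nonneg))).trans ih
  have hfloor : y + ⌊y' - y⌋₊ + Int.fract (y' - y) = y' := by
    rw [add_assoc, natCast_floor_eq_intCast_floor (sub_nonneg.2 hyy'), Int.floor_add_fract,
      add_sub_cancel]
  have hlast := hunit (y + ⌊y' - y⌋₊) (hy.trans (le_add_of_nonneg_right (Nat.cast_nonneg _)))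
    (Int.fract (y' - y)) ⟨Int.fract_nonneg _, (Int.fract_lt_one _).le⟩
  rw [hfloor] at hlast
  linarith [hnat ⌊y' - y⌋₊]

namespace RegVaryingAtTop

variable {φ : ℝ → ℝ} {α : ℝ}

theorem eventually_forall_ge_le_mul (hφ : RegVaryingAtTop φ α) (hα : α < 0) {K : ℝ}
    (hK : 1 < K) : ∀ᶠ t in atTop, ∀ s ≥ t, φ s ≤ K * φ t := by
  have hlogK := Real.log_pos hK
  obtain ⟨S, hS⟩ := eventually_atTop.1
    (hφ.eventually_forall_abs_log_sub_lt (lt_min hlogK (neg_pos.2 hα)))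
  have hone : ∀ y ≥ S, Real.log (φ (Real.exp (y + 1))) ≤ Real.log (φ (Real.exp y)) :=
    fun y hy => by
      have := ((abs_lt.1 (hS y hy 1 (by norm_num))).2).trans_le (min_le_right _ _)
      linarith
  have hunit : ∀ y ≥ S, ∀ u ∈ Icc (0 : ℝ) 1,
      Real.log (φ (Real.exp (y + u))) ≤ Real.log (φ (Real.exp y)) + Real.log K := by
    intro y hy u hu
    have := ((abs_lt.1 (hS y hy u ⟨by linarith [hu.1], hu.2⟩)).2).trans_le (min_le_left _ _)
    linarith [mul_nonpos_of_nonpos_of_nonneg hα.le hu.1]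
  filter_upwards [eventually_forall_ge_atTop.2 hφ.eventually_pos, eventually_gt_atTop 0,
    eventually_ge_atTop (Real.exp S)] with t hpos ht0 htS s hts
  have hlog := le_add_of_unit_steps (ℓ := fun y => Real.log (φ (Real.exp y))) hone hunit
    ((Real.le_log_iff_exp_le ht0).2 htS) (Real.log_le_log ht0 hts)
  have hφt := hpos t le_rfl
  rw [Real.exp_log ht0, Real.exp_log (ht0.trans_le hts), add_comm,
    ← Real.log_mul (by positivity) hφt.ne'] at hlog
  exact (Real.log_le_log_iff (hpos s hts) (by positivity)).1 hlog

theorem eventually_forall_ge_mul_le_mul (hφ : RegVaryingAtTop φ α) (hα : α < 0) {a K : ℝ}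
    (ha : 0 < a) (hK : a ^ α < K) : ∀ᶠ t in atTop, ∀ s ≥ a * t, φ s ≤ K * φ t := by
  have haα := Real.rpow_pos_of_pos ha α
  obtain ⟨c, hac, hcK⟩ := exists_between hK
  have hc := haα.trans hac
  have hat : Tendsto (fun t => a * t) atTop atTop := tendsto_id.const_mul_atTop ha
  filter_upwards [hat.eventually (hφ.eventually_forall_ge_le_mul hα ((one_lt_div hc).2 hcK)),
    (hφ.2 a ha).eventually_lt_const hac, hφ.eventually_pos] with t hmono hratio hφt s hs
  calc φ s ≤ K / c * φ (a * t) := hmono s hs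
    _ ≤ K / c * (c * φ t) := by
        have hK0 := hc.trans hcK
        gcongr
        exact ((div_lt_iff₀ hφt).1 hratio).le
    _ = K * φ t := by field_simp

end RegVaryingAtTop

namespace RegVaryingAtZero

variable {f : ℝ → ℝ} {β : ℝ}

theorem comp_inv (hf : RegVaryingAtZero f β) : RegVaryingAtTop (fun t => f t⁻¹) (-β) := by
  obtain ⟨⟨δ, hδ, hm, hpos⟩, hlim⟩ := hf
  have hmaps : ∀ t ∈ Ioi δ⁻¹, t⁻¹ ∈ Ioo 0 δ := fun t ht =>
    ⟨inv_pos.2 ((inv_pos.2 hδ).trans ht), inv_lt_of_inv_lt₀ hδ ht⟩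
  refine ⟨⟨δ⁻¹, ?_, fun t ht => hpos _ (hmaps t ht)⟩, fun lam hlam => ?_⟩
  · exact hm.comp (measurable_subtype_coe.inv.subtype_mk (h := fun t => hmaps t t.2))
  · rw [Real.rpow_neg hlam.le, ← Real.inv_rpow hlam.le]
    simpa only [Function.comp_def, mul_inv] using
      (hlim lam⁻¹ (inv_pos.2 hlam)).comp tendsto_inv_atTop_nhdsGT_zero

theorem tendsto_comp_div (hf : RegVaryingAtZero f β) {ι : Type*} {l : Filter ι} {w y : ι → ℝ}
    {ρ : ℝ} (hρ : 0 < ρ) (hy : Tendsto y l (𝓝[>] 0))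
    (hwy : Tendsto (fun i => w i / y i) l (𝓝 ρ)) :
    Tendsto (fun i => f (w i) / f (y i)) l (𝓝 (ρ ^ β)) := by
  have hinv := hf.comp_inv.tendsto_comp_div (w := fun i => (w i)⁻¹) (inv_pos.2 hρ)
    (tendsto_inv_nhdsGT_zero.comp hy) (by simpa [div_eq_mul_inv, mul_comm] using hwy.inv₀ hρ.ne')
  simpa [Real.inv_rpow hρ.le, Real.rpow_neg hρ.le] using hinv

theorem exists_eventually_le_mul (hf : RegVaryingAtZero f β) (hβ : 1 < β) :
    ∃ C, 0 < C ∧ ∀ᶠ u in 𝓝[>] 0, f u ≤ C * u := by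
  have hquot : RegVaryingAtTop (fun t => f t⁻¹ * t) (-β + 1) := hf.comp_inv.mul_id
  obtain ⟨T, hT, hTpos⟩ := ((hquot.eventually_forall_ge_le_mul (by linarith) one_lt_two).and
    hquot.eventually_pos).exists
  refine ⟨2 * (f T⁻¹ * T), by positivity, ?_⟩
  filter_upwards [self_mem_nhdsWithin, tendsto_inv_nhdsGT_zero.eventually_ge_atTop T]
    with u hu huT
  have hle := hT u⁻¹ huT
  rwa [inv_inv, ← div_eq_mul_inv, div_le_iff₀ hu] at hle

end RegVaryingAtZero

/-! ### L'Hôpital's rule for a denominator tending to infinity -/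

section LHopital

variable {F F' G G' : ℝ → ℝ} {a : ℝ}

theorem eventually_lt_mul_of_hasDerivAt {c d : ℝ} (hF : ∀ᶠ u in 𝓝[>] a, HasDerivAt F (F' u) u)
    (hG : ∀ᶠ u in 𝓝[>] a, HasDerivAt G (G' u) u) (hle : ∀ᶠ u in 𝓝[>] a, c * F' u ≤ G' u)
    (hF_top : Tendsto F (𝓝[>] a) atTop) (hcd : c < d) : ∀ᶠ u in 𝓝[>] a, G u < d * F u := by
  obtain ⟨b, hab, hb⟩ := mem_nhdsGT_iff_exists_Ioc_subset.1 ((hF.and hG).and hle)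
  have hderiv : ∀ u ∈ Ioc a b, HasDerivAt (fun u => c * F u - G u) (c * F' u - G' u) u :=
    fun u hu => ((hb hu).1.1.const_mul c).sub (hb hu).1.2
  have hanti : AntitoneOn (fun u => c * F u - G u) (Ioc a b) :=
    antitoneOn_of_hasDerivWithinAt_nonpos (convex_Ioc a b)
      (fun u hu => (hderiv u hu).continuousAt.continuousWithinAt)
      (fun u hu => (hderiv u (interior_subset hu)).hasDerivWithinAt)
      fun u hu => sub_nonpos.2 (hb (interior_subset hu)).2
  filter_upwards [Ioc_mem_nhdsGT hab,
    hF_top.eventually_gt_atTop (-(c * F b - G b) / (d - c))] with u hu hFu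
  have hbu : c * F b - G b ≤ c * F u - G u := hanti hu (right_mem_Ioc.2 hab) hu.2
  rw [div_lt_iff₀ (sub_pos.2 hcd)] at hFu
  linarith

theorem tendsto_div_nhdsGT_of_hasDerivAt {l : ℝ} (hF : ∀ᶠ u in 𝓝[>] a, HasDerivAt F (F' u) u)
    (hG : ∀ᶠ u in 𝓝[>] a, HasDerivAt G (G' u) u) (hF' : ∀ᶠ u in 𝓝[>] a, F' u < 0)
    (hF_top : Tendsto F (𝓝[>] a) atTop)
    (hlim : Tendsto (fun u => G' u / F' u) (𝓝[>] a) (𝓝 l)) :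
    Tendsto (fun u => G u / F u) (𝓝[>] a) (𝓝 l) := by
  refine tendsto_order.2 ⟨fun d hd => ?_, fun d hd => ?_⟩
  · obtain ⟨c, hdc, hcl⟩ := exists_between hd
    have hle : ∀ᶠ u in 𝓝[>] a, -c * F' u ≤ -G' u := by
      filter_upwards [hF', hlim.eventually_const_lt hcl] with u hu hcu
      linarith [(lt_div_iff_of_neg hu).1 hcu]
    filter_upwards [hF_top.eventually_gt_atTop 0, eventually_lt_mul_of_hasDerivAt hF
      (hG.mono fun u hu => hu.neg) hle hF_top (neg_lt_neg hdc)] with u hu hlt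
    rw [lt_div_iff₀ hu]
    simp only [Pi.neg_apply] at hlt
    linarith
  · obtain ⟨c, hlc, hcd⟩ := exists_between hd
    have hle : ∀ᶠ u in 𝓝[>] a, c * F' u ≤ G' u := by
      filter_upwards [hF', hlim.eventually_lt_const hlc] with u hu hcu
      exact ((div_lt_iff_of_neg hu).1 hcu).le
    filter_upwards [hF_top.eventually_gt_atTop 0,
      eventually_lt_mul_of_hasDerivAt hF hG hle hF_top hcd] with u hu hlt
    exact (div_lt_iff₀ hu).2 hlt

end LHopital

/-! ### The functions `F` and `F⁻¹` -/

section OdeF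

variable {f : ℝ → ℝ}

theorem hasDerivAt_odeF (hf_cont : ContinuousOn f (Ioi 0)) (hf_pos : ∀ u, 0 < u → 0 < f u)
    {u : ℝ} (hu : 0 < u) : HasDerivAt (odeF f) (-(1 / f u)) u := by
  have hc : ContinuousOn (fun u => 1 / f u) (Ioi 0) :=
    continuousOn_const.div hf_cont fun x hx => (hf_pos x hx).ne'
  have hsub : uIcc u 1 ⊆ Ioi 0 := fun x hx => (lt_min hu one_pos).trans_le hx.1
  exact intervalIntegral.integral_hasDerivAt_left (hc.mono hsub).intervalIntegrable
    (hc.stronglyMeasurableAtFilter isOpen_Ioi u hu) (hc.continuousAt (Ioi_mem_nhds hu))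

theorem continuousOn_odeF (hf_cont : ContinuousOn f (Ioi 0)) (hf_pos : ∀ u, 0 < u → 0 < f u) :
    ContinuousOn (odeF f) (Ioi 0) :=
  fun _ hu => (hasDerivAt_odeF hf_cont hf_pos hu).continuousAt.continuousWithinAt

theorem strictAntiOn_odeF (hf_cont : ContinuousOn f (Ioi 0)) (hf_pos : ∀ u, 0 < u → 0 < f u) :
    StrictAntiOn (odeF f) (Ioi 0) := by
  refine strictAntiOn_of_deriv_neg (convex_Ioi 0) (continuousOn_odeF hf_cont hf_pos)
    fun u hu => ?_
  rw [interior_Ioi] at hu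
  rw [(hasDerivAt_odeF hf_cont hf_pos hu).deriv, neg_lt_zero]
  exact one_div_pos.2 (hf_pos u hu)

theorem tendsto_odeF_atTop_of_le_mul (hf_cont : ContinuousOn f (Ioi 0))
    (hf_pos : ∀ u, 0 < u → 0 < f u) {C : ℝ} (hC : 0 < C) (hf_le : ∀ᶠ u in 𝓝[>] 0, f u ≤ C * u) :
    Tendsto (odeF f) (𝓝[>] 0) atTop := by
  have hlog : Tendsto (fun u => -Real.log u) (𝓝[>] 0) atTop :=
    tendsto_neg_atBot_atTop.comp Real.tendsto_log_nhdsGT_zero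
  have hpos : ∀ᶠ u : ℝ in 𝓝[>] 0, 0 < u := self_mem_nhdsWithin
  have hlt : ∀ᶠ u in 𝓝[>] 0, -odeF f u < -(C⁻¹ / 2) * -Real.log u := by
    refine eventually_lt_mul_of_hasDerivAt (c := -C⁻¹)
      (hpos.mono fun u hu => (Real.hasDerivAt_log hu.ne').neg)
      (hpos.mono fun u hu => (hasDerivAt_odeF hf_cont hf_pos hu).neg) ?_ hlog
      (neg_lt_neg (half_lt_self (inv_pos.2 hC)))
    filter_upwards [hpos, hf_le] with u hu hfu
    rw [neg_mul_neg, neg_neg, ← mul_inv, one_div]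
    exact inv_anti₀ (hf_pos u hu) hfu
  refine tendsto_atTop_mono' _ ?_ (hlog.const_mul_atTop (half_pos (inv_pos.2 hC)))
  filter_upwards [hlt] with u hu
  linarith

theorem surjOn_odeF (hf_cont : ContinuousOn f (Ioi 0)) (hf_pos : ∀ u, 0 < u → 0 < f u)
    (hF_top : Tendsto (odeF f) (𝓝[>] 0) atTop) : SurjOn (odeF f) (Ioi 0) (Ici 0) := by
  intro t ht
  obtain ⟨u, htu, hu⟩ := ((hF_top.eventually_ge_atTop t).and
    (Ioc_mem_nhdsGT (one_pos (α := ℝ)))).exists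
  have hF_one : odeF f 1 = 0 := intervalIntegral.integral_same
  have hsub : Icc u 1 ⊆ Ioi 0 := fun v hv => hu.1.trans_le hv.1
  obtain ⟨v, hv, hvt⟩ := intermediate_value_Icc' hu.2
    ((continuousOn_odeF hf_cont hf_pos).mono hsub) ⟨hF_one.le.trans ht, htu⟩
  exact ⟨v, hsub hv, hvt⟩

theorem odeFInv_pos (hf_cont : ContinuousOn f (Ioi 0)) (hf_pos : ∀ u, 0 < u → 0 < f u)
    (hF_top : Tendsto (odeF f) (𝓝[>] 0) atTop) {t : ℝ} (ht : 0 ≤ t) : 0 < odeFInv f t :=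
  (surjOn_odeF hf_cont hf_pos hF_top).mapsTo_invFunOn ht

theorem odeF_odeFInv (hf_cont : ContinuousOn f (Ioi 0)) (hf_pos : ∀ u, 0 < u → 0 < f u)
    (hF_top : Tendsto (odeF f) (𝓝[>] 0) atTop) {t : ℝ} (ht : 0 ≤ t) :
    odeF f (odeFInv f t) = t :=
  (surjOn_odeF hf_cont hf_pos hF_top).rightInvOn_invFunOn ht

theorem odeFInv_odeF (hf_cont : ContinuousOn f (Ioi 0)) (hf_pos : ∀ u, 0 < u → 0 < f u) {u : ℝ}
    (hu : 0 < u) : odeFInv f (odeF f u) = u :=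
  (strictAntiOn_odeF hf_cont hf_pos).injOn.leftInvOn_invFunOn hu

theorem odeFInv_lt_iff (hf_cont : ContinuousOn f (Ioi 0)) (hf_pos : ∀ u, 0 < u → 0 < f u)
    (hF_top : Tendsto (odeF f) (𝓝[>] 0) atTop) {t u : ℝ} (ht : 0 ≤ t) (hu : 0 < u) :
    odeFInv f t < u ↔ odeF f u < t := by
  rw [← (strictAntiOn_odeF hf_cont hf_pos).lt_iff_gt hu (odeFInv_pos hf_cont hf_pos hF_top ht),
    odeF_odeFInv hf_cont hf_pos hF_top ht]

theorem lt_odeFInv_iff (hf_cont : ContinuousOn f (Ioi 0)) (hf_pos : ∀ u, 0 < u → 0 < f u)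
    (hF_top : Tendsto (odeF f) (𝓝[>] 0) atTop) {t u : ℝ} (ht : 0 ≤ t) (hu : 0 < u) :
    u < odeFInv f t ↔ t < odeF f u := by
  rw [← (strictAntiOn_odeF hf_cont hf_pos).lt_iff_gt (odeFInv_pos hf_cont hf_pos hF_top ht) hu,
    odeF_odeFInv hf_cont hf_pos hF_top ht]

theorem antitoneOn_odeFInv (hf_cont : ContinuousOn f (Ioi 0)) (hf_pos : ∀ u, 0 < u → 0 < f u)
    (hF_top : Tendsto (odeF f) (𝓝[>] 0) atTop) : AntitoneOn (odeFInv f) (Ici 0) := by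
  intro s hs t ht hst
  by_contra! hlt
  rw [lt_odeFInv_iff hf_cont hf_pos hF_top ht (odeFInv_pos hf_cont hf_pos hF_top hs),
    odeF_odeFInv hf_cont hf_pos hF_top hs] at hlt
  exact hst.not_gt hlt

theorem tendsto_odeFInv (hf_cont : ContinuousOn f (Ioi 0)) (hf_pos : ∀ u, 0 < u → 0 < f u)
    (hF_top : Tendsto (odeF f) (𝓝[>] 0) atTop) : Tendsto (odeFInv f) atTop (𝓝[>] 0) := by
  have hpos : ∀ᶠ t in atTop, 0 < odeFInv f t :=
    (eventually_ge_atTop 0).mono fun t ht => odeFInv_pos hf_cont hf_pos hF_top ht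
  refine tendsto_nhdsWithin_iff.2 ⟨tendsto_order.2 ⟨fun a ha => ?_, fun a ha => ?_⟩, hpos⟩
  · exact hpos.mono fun t ht => ha.trans ht
  · filter_upwards [eventually_ge_atTop 0, eventually_gt_atTop (odeF f a)] with t ht hta
    exact (odeFInv_lt_iff hf_cont hf_pos hF_top ht ha).2 hta

end OdeF

namespace RegVaryingAtZero

variable {f : ℝ → ℝ} {β : ℝ}

theorem tendsto_odeF_atTop (hf : RegVaryingAtZero f β) (hβ : 1 < β)
    (hf_cont : ContinuousOn f (Ioi 0)) (hf_pos : ∀ u, 0 < u → 0 < f u) :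
    Tendsto (odeF f) (𝓝[>] 0) atTop := by
  obtain ⟨C, hC, hf_le⟩ := hf.exists_eventually_le_mul hβ
  exact tendsto_odeF_atTop_of_le_mul hf_cont hf_pos hC hf_le

theorem tendsto_odeF_mul_div (hf : RegVaryingAtZero f β) (hβ : 1 < β)
    (hf_cont : ContinuousOn f (Ioi 0)) (hf_pos : ∀ u, 0 < u → 0 < f u) {μ : ℝ} (hμ : 0 < μ) :
    Tendsto (fun u => odeF f (μ * u) / odeF f u) (𝓝[>] 0) (𝓝 (μ ^ (1 - β))) := by
  have hpos : ∀ᶠ u : ℝ in 𝓝[>] 0, 0 < u := self_mem_nhdsWithin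
  refine tendsto_div_nhdsGT_of_hasDerivAt (F' := fun u => -(1 / f u))
    (G' := fun u => -(1 / f (μ * u)) * μ) (hpos.mono fun u hu => hasDerivAt_odeF hf_cont hf_pos hu)
    (hpos.mono fun u hu => ?_) (hpos.mono fun u hu => neg_lt_zero.2 (one_div_pos.2 (hf_pos u hu)))
    (hf.tendsto_odeF_atTop hβ hf_cont hf_pos) ?_
  · exact (hasDerivAt_odeF hf_cont hf_pos (mul_pos hμ hu)).comp u
      (by simpa using (hasDerivAt_id u).const_mul μ)
  · rw [Real.rpow_sub hμ, Real.rpow_one]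
    refine (tendsto_const_nhds.div (hf.2 μ hμ) (Real.rpow_pos_of_pos hμ β).ne').congr' ?_
    filter_upwards [hpos] with u hu
    have hfu := hf_pos u hu
    have hfμu := hf_pos _ (mul_pos hμ hu)
    simp only [Pi.div_apply]
    field_simp

theorem tendsto_odeFInv_mul_div (hf : RegVaryingAtZero f β) (hβ : 1 < β)
    (hf_cont : ContinuousOn f (Ioi 0)) (hf_pos : ∀ u, 0 < u → 0 < f u) {lam : ℝ}
    (hlam : 0 < lam) :
    Tendsto (fun t => odeFInv f (lam * t) / odeFInv f t) atTop
      (𝓝 (lam ^ (-(1 / (β - 1))))) := by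
  have hF_top := hf.tendsto_odeF_atTop hβ hf_cont hf_pos
  set ρ := lam ^ (-(1 / (β - 1))) with hρ_def
  have hρ : 0 < ρ := Real.rpow_pos_of_pos hlam _
  have hρ_rpow : ρ ^ (1 - β) = lam := by
    have hβ' : β - 1 ≠ 0 := by linarith
    rw [hρ_def, ← Real.rpow_mul hlam.le,
      show -(1 / (β - 1)) * (1 - β) = 1 by field_simp; ring, Real.rpow_one]
  have hF_lim {μ : ℝ} (hμ : 0 < μ) :
      Tendsto (fun t => odeF f (μ * odeFInv f t) / t) atTop (𝓝 (μ ^ (1 - β))) := by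
    refine ((hf.tendsto_odeF_mul_div hβ hf_cont hf_pos hμ).comp
      (tendsto_odeFInv hf_cont hf_pos hF_top)).congr' ?_
    filter_upwards [eventually_ge_atTop 0] with t ht
    rw [Function.comp_apply, odeF_odeFInv hf_cont hf_pos hF_top ht]
  refine tendsto_order.2 ⟨fun a ha => ?_, fun b hb => ?_⟩
  · obtain ⟨μ, hμ, hμρ⟩ := exists_between (max_lt ha hρ)
    obtain ⟨haμ, hμ0⟩ := max_lt_iff.1 hμ
    have hlt : lam < μ ^ (1 - β) :=
      hρ_rpow.symm.trans_lt (Real.rpow_lt_rpow_of_neg hμ0 hμρ (by linarith))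
    filter_upwards [eventually_gt_atTop 0, (hF_lim hμ0).eventually_const_lt hlt] with t ht hFt
    have hy := odeFInv_pos hf_cont hf_pos hF_top ht.le
    refine haμ.trans ((lt_div_iff₀ hy).2 ?_)
    rwa [lt_odeFInv_iff hf_cont hf_pos hF_top (by positivity) (mul_pos hμ0 hy), ← lt_div_iff₀ ht]
  · have hb0 := hρ.trans hb
    have hlt : b ^ (1 - β) < lam :=
      (Real.rpow_lt_rpow_of_neg hρ hb (by linarith)).trans_eq hρ_rpow
    filter_upwards [eventually_gt_atTop 0, (hF_lim hb0).eventually_lt_const hlt] with t ht hFt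
    have hy := odeFInv_pos hf_cont hf_pos hF_top ht.le
    rwa [div_lt_iff₀ hy, odeFInv_lt_iff hf_cont hf_pos hF_top (by positivity) (mul_pos hb0 hy),
      ← div_lt_iff₀ ht]

theorem comp_odeFInv (hf : RegVaryingAtZero f β) (hβ : 1 < β)
    (hf_cont : ContinuousOn f (Ioi 0)) (hf_pos : ∀ u, 0 < u → 0 < f u) :
    RegVaryingAtTop (fun t => f (odeFInv f t)) (-(β / (β - 1))) := by
  have hF_top := hf.tendsto_odeF_atTop hβ hf_cont hf_pos
  have hpos : ∀ t ∈ Ioi (0 : ℝ), 0 < odeFInv f t :=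
    fun t ht => odeFInv_pos hf_cont hf_pos hF_top (Ioi_subset_Ici_self ht)
  refine ⟨⟨0, ?_, fun t ht => hf_pos _ (hpos t ht)⟩, fun lam hlam => ?_⟩
  · have hinv : Antitone ((Ioi 0).domRestrict (odeFInv f)) := fun s t hst =>
      antitoneOn_odeFInv hf_cont hf_pos hF_top (Ioi_subset_Ici_self s.2)
        (Ioi_subset_Ici_self t.2) hst
    exact hf_cont.domRestrict.measurable.comp
      (hinv.measurable.subtype_mk (h := fun t => hpos t t.2))
  · have hcomp := hf.tendsto_comp_div (Real.rpow_pos_of_pos hlam _)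
      (tendsto_odeFInv hf_cont hf_pos hF_top) (hf.tendsto_odeFInv_mul_div hβ hf_cont hf_pos hlam)
    rwa [← Real.rpow_mul hlam.le, show -(1 / (β - 1)) * β = -(β / (β - 1)) by ring] at hcomp

end RegVaryingAtZero

/-! ### The equation `z' = 1 - g / φ(z)` -/

section Barrier

variable {z z' : ℝ → ℝ} {κ : ℝ}

theorem le_sub_mul_of_lt_deriv {T t : ℝ} (hTt : T ≤ t) (hκ : 0 ≤ κ)
    (hz : ∀ s ∈ Icc T t, HasDerivAt z (z' s) s) (h : ∀ s ∈ Icc T t, z s ≤ z t → κ < z' s) :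
    z T ≤ z t - κ * (t - T) := by
  -- Reversing time turns the value at `t` into the initial value required by the fencing lemma.
  have hmem : ∀ r ∈ Icc 0 (t - T), t - r ∈ Icc T t := fun r hr =>
    ⟨by linarith [hr.2], by linarith [hr.1]⟩
  have hrev : ∀ r ∈ Icc 0 (t - T), HasDerivAt (fun r => z (t - r)) (-z' (t - r)) r :=
    fun r hr => (hz _ (hmem r hr)).comp_const_sub t r
  have hline (r : ℝ) : HasDerivAt (fun r => z t - κ * r) (-κ) r := by
    simpa using ((hasDerivAt_id r).const_mul κ).const_sub (z t)
  have hle : ∀ ⦃r⦄, r ∈ Icc 0 (t - T) → z (t - r) ≤ z t - κ * r := by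
    refine image_le_of_deriv_right_lt_deriv_boundary
      (fun r hr => (hrev r hr).continuousAt.continuousWithinAt)
      (fun r hr => (hrev r (Ico_subset_Icc_self hr)).hasDerivWithinAt) (by simp) hline
      fun r hr hr_eq => neg_lt_neg (h _ (hmem r (Ico_subset_Icc_self hr)) ?_)
    rw [hr_eq]
    exact sub_le_self _ (mul_nonneg hκ hr.1)
  simpa using hle (right_mem_Icc.2 (sub_nonneg.2 hTt))

theorem add_mul_le_of_deriv_lt {T t : ℝ} (hTt : T ≤ t) (hκ : 0 ≤ κ)
    (hz : ∀ s ∈ Icc T t, HasDerivAt z (z' s) s) (h : ∀ s ∈ Icc T t, z t ≤ z s → z' s < -κ) :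
    z t + κ * (t - T) ≤ z T := by
  have hneg := le_sub_mul_of_lt_deriv hTt hκ (fun s hs => (hz s hs).neg) fun s hs hst =>
    lt_neg_of_lt_neg (h s hs (neg_le_neg_iff.1 hst))
  simp only [Pi.neg_apply] at hneg
  linarith

theorem eventually_neg_of_deriv_lt (hκ : 0 < κ) (hz : ∀ᶠ t in atTop, HasDerivAt z (z' t) t)
    (h : ∀ᶠ t in atTop, 0 ≤ z t → z' t < -κ) : ∀ᶠ t in atTop, z t < 0 := by
  obtain ⟨T, hT⟩ := eventually_atTop.1 (hz.and h)
  filter_upwards [eventually_ge_atTop T, eventually_gt_atTop (T + z T / κ)] with t htT ht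
  by_contra! hzt
  have hle := add_mul_le_of_deriv_lt htT hκ.le (fun s hs => (hT s hs.1).1)
    fun s hs hs' => (hT s hs.1).2 (hzt.trans hs')
  have hlt : z T < κ * (t - T) := (div_lt_iff₀' hκ).1 (lt_sub_iff_add_lt'.2 ht)
  linarith

end Barrier

theorem exists_one_lt_pow_three_lt {k : ℝ} (hk : 1 < k) : ∃ r > 1, r ^ 3 < k :=
  (((continuous_pow 3).tendsto (1 : ℝ)).eventually_lt_const (by simpa using hk)).exists_gt

/-- `z` tends to infinity and satisfies `z'(t) = 1 - g(t) / φ(z(t))` for all large `t`. If `x`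
solves `x' = -f(x) + g`, then `z = F ∘ x` has this property with `φ = f ∘ F⁻¹`. -/
structure IsRescaledSolution (φ g z : ℝ → ℝ) : Prop where
  eventually_hasDerivAt : ∀ᶠ t in atTop, HasDerivAt z (1 - g t / φ (z t)) t
  tendsto_atTop : Tendsto z atTop atTop

namespace IsRescaledSolution

variable {φ g z : ℝ → ℝ} {γ : ℝ}

theorem eventually_lt_mul (hz : IsRescaledSolution φ g z) (hφ : RegVaryingAtTop φ (-γ))
    (hγ : 0 < γ) {b m : ℝ} (hb : 0 < b) (hm : 0 ≤ m) (hg : ∀ᶠ t in atTop, m * φ t ≤ g t)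
    (hbm : 1 - b < m * b ^ γ) : ∀ᶠ t in atTop, z t < b * t := by
  have hbγ := Real.rpow_pos_of_pos hb (-γ)
  obtain ⟨K, hK, hKb⟩ : ∃ K > b ^ (-γ), 1 - m / K < b := by
    have hcont : ContinuousAt (fun K : ℝ => 1 - m / K) (b ^ (-γ)) :=
      continuousAt_const.sub (continuousAt_const.div continuousAt_id hbγ.ne')
    refine (hcont.eventually_lt_const ?_).exists_gt
    beta_reduce
    rw [Real.rpow_neg hb.le, div_inv_eq_mul]
    linarith
  have hK0 : 0 < K := hbγ.trans hK
  obtain ⟨κ, hκ0, hκ⟩ := exists_between (sub_pos.2 hKb)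
  have hneg : ∀ᶠ t in atTop, z t - b * t < 0 := by
    refine eventually_neg_of_deriv_lt (z' := fun t => 1 - g t / φ (z t) - b) hκ0
      (hz.eventually_hasDerivAt.mono fun t ht =>
        ht.fun_sub (by simpa using (hasDerivAt_id t).const_mul b)) ?_
    filter_upwards [hz.tendsto_atTop.eventually hφ.eventually_pos, hg,
      hφ.eventually_forall_ge_mul_le_mul (neg_lt_zero.2 hγ) hb hK] with t hφz hmg hφK hbz
    have hquot : m / K ≤ g t / φ (z t) := by
      rw [div_le_div_iff₀ hK0 hφz]
      calc m * φ (z t) ≤ m * (K * φ t) := by gcongr; exact hφK _ (sub_nonneg.1 hbz)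
        _ = m * φ t * K := by ring
        _ ≤ g t * K := by gcongr
    linarith
  exact hneg.mono fun t => sub_neg.1

theorem eventually_mul_lt (hz : IsRescaledSolution φ g z) (hφ : RegVaryingAtTop φ (-γ))
    (hγ : 0 < γ) {a m : ℝ} (ha : 0 < a) (hm : 0 ≤ m) (hg : ∀ᶠ t in atTop, g t ≤ m * φ t)
    (ham : m * a ^ γ < 1 - a) : ∀ᶠ t in atTop, a * t < z t := by
  obtain ⟨K, hK, hKa⟩ : ∃ K > a ^ γ, m * K < 1 - a :=
    (((continuous_const_mul m).tendsto (a ^ γ)).eventually_lt_const ham).exists_gt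
  have hK' : a⁻¹ ^ (-γ) < K := by
    rwa [Real.inv_rpow ha.le, Real.rpow_neg ha.le, inv_inv]
  obtain ⟨κ, hκ0, hκ⟩ := exists_between (sub_pos.2 hKa)
  have hneg : ∀ᶠ t in atTop, a * t - z t < 0 := by
    refine eventually_neg_of_deriv_lt (z' := fun t => a - (1 - g t / φ (z t))) hκ0
      (hz.eventually_hasDerivAt.mono fun t ht =>
        HasDerivAt.fun_sub (by simpa using (hasDerivAt_id t).const_mul a) ht) ?_
    filter_upwards [hz.tendsto_atTop.eventually hφ.eventually_pos, hg, hz.tendsto_atTop.eventually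
      (hφ.eventually_forall_ge_mul_le_mul (neg_lt_zero.2 hγ) (inv_pos.2 ha) hK')]
      with t hφz hgm hφK haz
    have hquot : g t / φ (z t) ≤ m * K := by
      rw [div_le_iff₀ hφz]
      calc g t ≤ m * φ t := hgm
        _ ≤ m * (K * φ (z t)) := by
          gcongr
          exact hφK t ((inv_mul_le_iff₀ ha).2 (sub_nonneg.1 haz))
        _ = m * K * φ (z t) := by ring
    linarith
  exact hneg.mono fun t => sub_neg.1

theorem tendsto_div (hz : IsRescaledSolution φ g z) (hφ : RegVaryingAtTop φ (-γ))
    (hγ : 0 < γ) (hg_pos : ∀ᶠ t in atTop, 0 < g t) {l Λ : ℝ}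
    (hlim : Tendsto (fun t => g t / φ t) atTop (𝓝 l)) (hΛ : 0 < Λ) (hΛl : 1 - Λ = l * Λ ^ γ) :
    Tendsto (fun t => z t / t) atTop (𝓝 Λ) := by
  have hl : 0 ≤ l := ge_of_tendsto hlim <| by
    filter_upwards [hg_pos, hφ.eventually_pos] with t hgt hφt using (div_pos hgt hφt).le
  refine tendsto_order.2 ⟨fun a' ha' => ?_, fun b hb => ?_⟩
  · obtain ⟨a, haa', haΛ⟩ := exists_between (max_lt ha' hΛ)
    obtain ⟨ha'a, ha⟩ := max_lt_iff.1 haa'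
    have haγ := Real.rpow_pos_of_pos ha γ
    obtain ⟨m, hlm, hma⟩ : ∃ m, l < m ∧ m < (1 - a) / a ^ γ := by
      refine exists_between ((lt_div_iff₀ haγ).2 ?_)
      calc l * a ^ γ ≤ l * Λ ^ γ := by gcongr
        _ < 1 - a := by linarith
    have hgm : ∀ᶠ t in atTop, g t ≤ m * φ t := by
      filter_upwards [hlim.eventually_lt_const hlm, hφ.eventually_pos] with t ht hφt
      exact ((div_lt_iff₀ hφt).1 ht).le
    filter_upwards [hz.eventually_mul_lt hφ hγ ha (hl.trans hlm.le) hgm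
      ((lt_div_iff₀ haγ).1 hma), eventually_gt_atTop 0] with t hzt ht
    exact ha'a.trans ((lt_div_iff₀ ht).2 hzt)
  · have hb0 := hΛ.trans hb
    have hbγ := Real.rpow_pos_of_pos hb0 γ
    obtain ⟨m, hbm, hml⟩ : ∃ m, (1 - b) / b ^ γ < m ∧ m < l := by
      refine exists_between ((div_lt_iff₀ hbγ).2 ?_)
      calc 1 - b < l * Λ ^ γ := by linarith
        _ ≤ l * b ^ γ := by gcongr
    have hmg : ∀ᶠ t in atTop, max m 0 * φ t ≤ g t := by
      filter_upwards [hlim.eventually_const_lt hml, hφ.eventually_pos, hg_pos] with t ht hφt hgt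
      rw [max_mul_of_nonneg _ _ hφt.le, zero_mul]
      exact max_le ((lt_div_iff₀ hφt).1 ht).le hgt.le
    have hbm' : 1 - b < max m 0 * b ^ γ :=
      (div_lt_iff₀ hbγ).1 (hbm.trans_le (le_max_left m 0))
    filter_upwards [hz.eventually_lt_mul hφ hγ hb0 (le_max_right m 0) hmg hbm',
      eventually_gt_atTop 0] with t hzt ht
    exact (div_lt_iff₀ ht).2 hzt

theorem eventually_lt_mul_of_tendsto_atTop (hz : IsRescaledSolution φ g z)
    (hφ : RegVaryingAtTop φ (-γ)) (hγ : 0 < γ)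
    (hlim : Tendsto (fun t => g t / φ t) atTop atTop) {c : ℝ} (hc : 0 < c) :
    ∀ᶠ t in atTop, z t < c * t := by
  have hcγ := Real.rpow_pos_of_pos hc γ
  refine hz.eventually_lt_mul hφ hγ (m := 1 / c ^ γ) hc (by positivity) ?_ ?_
  · filter_upwards [hlim.eventually_ge_atTop (1 / c ^ γ), hφ.eventually_pos] with t ht hφt
    exact (le_div_iff₀ hφt).1 ht
  · rw [one_div_mul_cancel hcγ.ne']
    exact sub_lt_self 1 hc

variable {α : ℝ}

theorem eventually_comp_lt_mul (hz : IsRescaledSolution φ g z) (hφ : RegVaryingAtTop φ (-γ))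
    (hγ : 0 < γ) (hg : RegVaryingAtTop g α)
    (hlim : Tendsto (fun t => g t / φ t) atTop atTop) {k : ℝ}
    (hk : 1 < k) : ∀ᶠ t in atTop, φ (z t) < k * g t := by
  obtain ⟨r, hr, hrk⟩ := exists_one_lt_pow_three_lt hk
  have hr0 : 0 < r := one_pos.trans hr
  have hκ : 0 < 1 - r⁻¹ := sub_pos.2 (inv_lt_one_of_one_lt₀ hr)
  obtain ⟨c, ⟨hc0, hc1⟩, hgc⟩ := hg.exists_eventually_forall_Icc_le_mul hr
  have hlocal : ∀ᶠ s in atTop, HasDerivAt z (1 - g s / φ (z s)) s ∧ 0 < z s ∧ 0 < φ (z s) ∧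
      ∀ v ≥ z s, φ v ≤ r * φ (z s) :=
    hz.eventually_hasDerivAt.and <| (hz.tendsto_atTop.eventually_gt_atTop 0).and <|
      hz.tendsto_atTop.eventually <| hφ.eventually_pos.and <|
      hφ.eventually_forall_ge_le_mul (neg_lt_zero.2 hγ) hr
  filter_upwards [eventually_gt_atTop 0, hgc, hg.eventually_pos,
    (tendsto_id.const_mul_atTop hc0).eventually (eventually_forall_ge_atTop.2 hlocal),
    hz.eventually_lt_mul_of_tendsto_atTop hφ hγ hlim (mul_pos hκ (sub_pos.2 hc1))]
    with t ht hgt hgt0 hs hzt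
  have hct : c * t ≤ t := mul_le_of_le_one_left ht.le hc1.le
  by_contra! hφg
  have hslope : ∀ s ∈ Icc (c * t) t, z s ≤ z t → 1 - r⁻¹ < 1 - g s / φ (z s) := by
    intro s hst hzs
    obtain ⟨-, -, hφs, hφr⟩ := hs s hst.1
    refine sub_lt_sub_left ((div_lt_iff₀ hφs).2 ?_) 1
    rw [inv_mul_eq_div, lt_div_iff₀' hr0]
    refine lt_of_mul_lt_mul_left ?_ hr0.le
    calc r * (r * g s) ≤ r * (r * (r * g t)) := by gcongr; exact (hgt s hst).1
      _ = r ^ 3 * g t := by ring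
      _ < k * g t := by gcongr
      _ ≤ φ (z t) := hφg
      _ ≤ r * φ (z s) := hφr _ hzs
  have hle := le_sub_mul_of_lt_deriv hct hκ.le (fun s hst => (hs s hst.1).1) hslope
  have hpos := (hs (c * t) le_rfl).2.1
  linarith

theorem eventually_lt_mul_comp (hz : IsRescaledSolution φ g z) (hφ : RegVaryingAtTop φ (-γ))
    (hγ : 0 < γ) (hg : RegVaryingAtTop g α)
    (hlim : Tendsto (fun t => g t / φ t) atTop atTop) {k : ℝ}
    (hk : 1 < k) : ∀ᶠ t in atTop, g t < k * φ (z t) := by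
  obtain ⟨r, hr, hrk⟩ := exists_one_lt_pow_three_lt hk
  have hr0 : 0 < r := one_pos.trans hr
  obtain ⟨c, ⟨hc0, hc1⟩, hgc⟩ := hg.exists_eventually_forall_Icc_le_mul hr
  have hκ : 0 < (r - 1) * (1 - c) := mul_pos (sub_pos.2 hr) (sub_pos.2 hc1)
  have hct_top : Tendsto (fun t => c * t) atTop atTop := tendsto_id.const_mul_atTop hc0
  filter_upwards [eventually_gt_atTop 0, hgc, hct_top.eventually (eventually_forall_ge_atTop.2
      (hz.eventually_hasDerivAt.and (hz.tendsto_atTop.eventually hφ.eventually_pos))),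
    hz.tendsto_atTop.eventually_gt_atTop 0,
    hz.tendsto_atTop.eventually (hφ.eventually_forall_ge_le_mul (neg_lt_zero.2 hγ) hr),
    hct_top.eventually (hz.eventually_lt_mul_of_tendsto_atTop hφ hγ hlim hκ)]
    with t ht hgt hs hzt hφr hzct
  have hct : c * t ≤ t := mul_le_of_le_one_left ht.le hc1.le
  have hφt : 0 < φ (z t) := (hs t hct).2
  by_contra! hφg
  have hslope : ∀ s ∈ Icc (c * t) t, z t ≤ z s → 1 - g s / φ (z s) < -(r - 1) := by
    intro s hst hzs
    have hφs : 0 < φ (z s) := (hs s hst.1).2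
    have hquot : r < g s / φ (z s) := by
      rw [lt_div_iff₀ hφs]
      refine lt_of_mul_lt_mul_left ?_ hr0.le
      calc r * (r * φ (z s)) ≤ r * (r * (r * φ (z t))) := by gcongr; exact hφr _ hzs
        _ = r ^ 3 * φ (z t) := by ring
        _ < k * φ (z t) := by gcongr
        _ ≤ g t := hφg
        _ ≤ r * g s := (hgt s hst).2
    linarith
  have hle := add_mul_le_of_deriv_lt hct (sub_pos.2 hr).le (fun s hst => (hs s hst.1).1) hslope
  have hκt : (r - 1) * (1 - c) * (c * t) ≤ (r - 1) * (1 - c) * t := by gcongr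
  linarith

theorem tendsto_comp_div (hz : IsRescaledSolution φ g z) (hφ : RegVaryingAtTop φ (-γ))
    (hγ : 0 < γ) (hg : RegVaryingAtTop g α)
    (hlim : Tendsto (fun t => g t / φ t) atTop atTop) :
    Tendsto (fun t => φ (z t) / g t) atTop (𝓝 1) := by
  refine tendsto_order.2 ⟨fun a' ha' => ?_, fun k hk => ?_⟩
  · obtain ⟨a, haa', ha1⟩ := exists_between (max_lt ha' one_pos)
    obtain ⟨ha'a, ha⟩ := max_lt_iff.1 haa'
    filter_upwards [hg.eventually_pos,
      hz.eventually_lt_mul_comp hφ hγ hg hlim ((one_lt_inv₀ ha).2 ha1)] with t hgt ht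
    exact ha'a.trans ((lt_div_iff₀ hgt).2 ((lt_inv_mul_iff₀ ha).1 ht))
  · filter_upwards [hg.eventually_pos, hz.eventually_comp_lt_mul hφ hγ hg hlim hk]
      with t hgt ht
    exact (div_lt_iff₀ hgt).2 ht

end IsRescaledSolution

section FixedPoint

variable {l γ : ℝ}

theorem one_sub_mul_rpow_neg_eq_iff {Λ : ℝ} (hΛ : 0 < Λ) :
    (1 - Λ) * Λ ^ (-γ) = l ↔ 1 - Λ = l * Λ ^ γ := by
  rw [Real.rpow_neg hΛ.le, ← div_eq_mul_inv, div_eq_iff (Real.rpow_pos_of_pos hΛ γ).ne']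

theorem strictMonoOn_mul_rpow_add_id (hl : 0 ≤ l) (hγ : 0 ≤ γ) :
    StrictMonoOn (fun Λ : ℝ => l * Λ ^ γ + Λ) (Ici 0) := by
  intro a ha b _ hab
  exact add_lt_add_of_le_of_lt
    (mul_le_mul_of_nonneg_left (Real.rpow_le_rpow ha hab.le hγ) hl) hab

theorem existsUnique_mem_Ioo_one_sub_mul_rpow_neg_eq (hl : 0 < l) (hγ : 0 < γ) :
    ∃! Λ, Λ ∈ Ioo (0 : ℝ) 1 ∧ (1 - Λ) * Λ ^ (-γ) = l := by
  have hcont : ContinuousOn (fun Λ : ℝ => l * Λ ^ γ + Λ) (Icc 0 1) :=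
    (((Real.continuous_rpow_const hγ.le).const_mul l).add continuous_id).continuousOn
  have hiff {Λ : ℝ} (hΛ : Λ ∈ Ioo (0 : ℝ) 1) :
      (1 - Λ) * Λ ^ (-γ) = l ↔ l * Λ ^ γ + Λ = 1 := by
    rw [one_sub_mul_rpow_neg_eq_iff hΛ.1, sub_eq_iff_eq_add, eq_comm]
  obtain ⟨Λ, hΛ, hΛl⟩ := intermediate_value_Ioo zero_le_one hcont
    (show (1 : ℝ) ∈ Ioo _ _ by simp [Real.zero_rpow hγ.ne', hl])
  refine ⟨Λ, ⟨hΛ, (hiff hΛ).2 hΛl⟩, fun Λ' ⟨hΛ', hΛl'⟩ => ?_⟩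
  exact (strictMonoOn_mul_rpow_add_id hl.le hγ.le).injOn hΛ'.1.le hΛ.1.le
    (((hiff hΛ').1 hΛl').trans hΛl.symm)

end FixedPoint

/-! ### The perturbed equation -/

namespace IsPerturbedSolution

variable {f g x : ℝ → ℝ} {ξ : ℝ}

theorem pos (hx : IsPerturbedSolution f g ξ x) (hξ : 0 < ξ) (hf_zero : f 0 ≤ 0)
    (hg_pos : ∀ t, 0 < t → 0 < g t) {t : ℝ} (ht : 0 ≤ t) : 0 < x t := by
  by_contra! hxt
  have hclosed : IsClosed (Icc 0 t ∩ x ⁻¹' Iic 0) :=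
    (hx.continuousOn.mono Icc_subset_Ici_self).preimage_isClosed_of_isClosed isClosed_Icc
      isClosed_Iic
  obtain ⟨t₀, ⟨ht₀, hxt₀⟩, hleast⟩ := (isCompact_Icc.of_isClosed_subset hclosed
    inter_subset_left).exists_isLeast ⟨t, right_mem_Icc.2 ht, hxt⟩
  have ht₀_pos : 0 < t₀ := by
    refine ht₀.1.lt_of_ne fun h => hξ.not_ge ?_
    rwa [← h, mem_preimage, hx.initial] at hxt₀
  have hpos_left : ∀ᶠ s in 𝓝[<] t₀, 0 < x s := by
    filter_upwards [Ioo_mem_nhdsLT ht₀_pos] with s hs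
    by_contra! hxs
    exact hs.2.not_ge (hleast ⟨⟨hs.1.le, hs.2.le.trans ht₀.2⟩, hxs⟩)
  have hderiv := hx.hasDerivAt t₀ ht₀_pos
  have hzero : x t₀ = 0 := hxt₀.antisymm <|
    ge_of_tendsto (hderiv.continuousAt.mono_left nhdsWithin_le_nhds)
      (hpos_left.mono fun s hs => hs.le)
  have hsign := eventually_nhdsWithin_sign_eq_of_deriv_pos (f := x) (x₀ := t₀) (by
    rw [hderiv.deriv, hzero]
    linarith [hg_pos t₀ ht₀_pos]) hzero
  obtain ⟨s, ⟨hs_pos, hs_lt⟩, hs_sign⟩ := ((hpos_left.and self_mem_nhdsWithin).and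
    (hsign.filter_mono nhdsWithin_le_nhds)).exists
  rw [sign_pos hs_pos, sign_neg (sub_neg.2 hs_lt)] at hs_sign
  exact absurd hs_sign (by decide)

theorem hasDerivAt_odeF_comp (hx : IsPerturbedSolution f g ξ x) (hf_cont : ContinuousOn f (Ioi 0))
    (hf_pos : ∀ u, 0 < u → 0 < f u) {t : ℝ} (ht : 0 < t) (hxt : 0 < x t) :
    HasDerivAt (fun t => odeF f (x t)) (1 - g t / f (x t)) t := by
  have hfx := (hf_pos _ hxt).ne'
  refine ((hasDerivAt_odeF hf_cont hf_pos hxt).comp t (hx.hasDerivAt t ht)).congr_deriv ?_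
  field_simp
  ring

theorem isRescaledSolution (hx : IsPerturbedSolution f g ξ x) (hf_cont : ContinuousOn f (Ioi 0))
    (hf_pos : ∀ u, 0 < u → 0 < f u) (hF_top : Tendsto (odeF f) (𝓝[>] 0) atTop)
    (hx_lim : Tendsto x atTop (𝓝[>] 0)) :
    IsRescaledSolution (fun t => f (odeFInv f t)) g (fun t => odeF f (x t)) where
  eventually_hasDerivAt := by
    filter_upwards [eventually_gt_atTop 0, hx_lim.eventually self_mem_nhdsWithin] with t ht hxt
    rw [odeFInv_odeF hf_cont hf_pos hxt]
    exact hx.hasDerivAt_odeF_comp hf_cont hf_pos ht hxt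
  tendsto_atTop := hF_top.comp hx_lim

end IsPerturbedSolution

theorem mainTheorem1_general {f g x : ℝ → ℝ} {ξ β : ℝ} {L : EReal}
    (hf_cont : ContinuousOn f (Ioi 0)) (hf_zero : f 0 ≤ 0) (hf_pos : ∀ u, 0 < u → 0 < f u)
    (hg_pos : ∀ t, 0 < t → 0 < g t) (hξ : 0 < ξ) (hβ : 1 < β) (hf_rv : RegVaryingAtZero f β)
    (hx : IsPerturbedSolution f g ξ x) (hx_lim : Tendsto x atTop (𝓝 0))
    (hL : Tendsto (fun t : ℝ => ((g t / f (odeFInv f t) : ℝ) : EReal)) atTop (𝓝 L)) :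
    (L = 0 → Tendsto (fun t => odeF f (x t) / t) atTop (𝓝 1)) ∧
    (∀ l : ℝ, 0 < l → L = (l : EReal) →
      ∃ Λ : ℝ, (Λ ∈ Ioo (0 : ℝ) 1 ∧ (1 - Λ) * Λ ^ (-(β / (β - 1))) = l) ∧
        (∀ Λ' ∈ Ioo (0 : ℝ) 1, (1 - Λ') * Λ' ^ (-(β / (β - 1))) = l → Λ' = Λ) ∧
        Tendsto (fun t => odeF f (x t) / t) atTop (𝓝 Λ)) ∧
    (L = ⊤ → ∀ α : ℝ, RegVaryingAtTop g α → Tendsto (fun t => f (x t) / g t) atTop (𝓝 1)) := by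
  have hγ : 0 < β / (β - 1) := div_pos (one_pos.trans hβ) (sub_pos.2 hβ)
  have hφ := hf_rv.comp_odeFInv hβ hf_cont hf_pos
  have hx_lim' : Tendsto x atTop (𝓝[>] 0) := tendsto_nhdsWithin_iff.2
    ⟨hx_lim, (eventually_ge_atTop 0).mono fun t => hx.pos hξ hf_zero hg_pos⟩
  have hz := hx.isRescaledSolution hf_cont hf_pos
    (hf_rv.tendsto_odeF_atTop hβ hf_cont hf_pos) hx_lim'
  have hg_ev : ∀ᶠ t in atTop, 0 < g t := (eventually_gt_atTop 0).mono hg_pos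
  refine ⟨?_, ?_, ?_⟩
  · rintro rfl
    exact hz.tendsto_div hφ hγ hg_ev (EReal.tendsto_coe.1 hL) one_pos (by simp)
  · rintro l hl rfl
    obtain ⟨Λ, ⟨hΛ, hΛl⟩, huniq⟩ := existsUnique_mem_Ioo_one_sub_mul_rpow_neg_eq hl hγ
    exact ⟨Λ, ⟨hΛ, hΛl⟩, fun Λ' hΛ' hΛl' => huniq Λ' ⟨hΛ', hΛl'⟩,
      hz.tendsto_div hφ hγ hg_ev (EReal.tendsto_coe.1 hL) hΛ.1
        ((one_sub_mul_rpow_neg_eq_iff hΛ.1).1 hΛl)⟩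
  · rintro rfl α hg_rv
    refine (hz.tendsto_comp_div hφ hγ hg_rv (EReal.tendsto_coe_nhds_top_iff.1 hL)).congr' ?_
    filter_upwards [hx_lim'.eventually self_mem_nhdsWithin] with t hxt
    rw [odeFInv_odeF hf_cont hf_pos hxt]

theorem mainTheorem1 (f g x : ℝ → ℝ) (ξ β θ : ℝ) (L : EReal)
    (hf_sign : ∀ u : ℝ, u ≠ 0 → 0 < u * f u) (hf_zero : f 0 = 0)
    (hf_lip : LocallyLipschitz f)
    (hf_cont : Continuous f) (hg_cont : ContinuousOn g (Ici 0))
    (hg_pos : ∀ t : ℝ, 0 < t → 0 < g t) (hξ : 0 < ξ)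
    (hβ : 1 < β) (hf_rv : RegVaryingAtZero f β)
    (hθ : 0 < θ) (hg_rv : RegVaryingAtTop g (-θ))
    (hx : IsPerturbedSolution f g ξ x)
    (hx_lim : Tendsto x atTop (𝓝 0))
    (hL_nonneg : 0 ≤ L)
    (hL : Tendsto (fun t : ℝ => ((g t / f (odeFInv f t) : ℝ) : EReal)) atTop (𝓝 L)) :
    (L = 0 → Tendsto (fun t => odeF f (x t) / t) atTop (𝓝 1)) ∧
    (∀ l : ℝ, 0 < l → L = (l : EReal) →
      ∃ Λ : ℝ, (Λ ∈ Ioo (0 : ℝ) 1 ∧ (1 - Λ) * Λ ^ (-(β / (β - 1))) = l) ∧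
        (∀ Λ' ∈ Ioo (0 : ℝ) 1, (1 - Λ') * Λ' ^ (-(β / (β - 1))) = l → Λ' = Λ) ∧
        Tendsto (fun t => odeF f (x t) / t) atTop (𝓝 Λ)) ∧
    (L = ⊤ → Tendsto (fun t => f (x t) / g t) atTop (𝓝 1)) := by
  obtain ⟨hzero, hfin, htop⟩ := mainTheorem1_general hf_cont.continuousOn hf_zero.le
    (fun u hu => pos_of_mul_pos_right (hf_sign u hu.ne') hu.le) hg_pos hξ hβ hf_rv hx hx_lim hL
  exact ⟨hzero, hfin, fun h => htop h _ hg_rv⟩
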